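/- Let $(\mathbf k,\ ')$ be an ordinary differential field of characteristic $0$ (one derivation $x\mapsto x'$) that is differentially closed: for every $n$ and every finite set $F\subset\mathbf k\{y_1,\dots,y_n\}$ of differential polynomials, if the system $F=0$ has a solution with entries in some differential field extension of $\mathbf k$, then it has a solution with entries in $\mathbf k$. Identify $\mathbf k^\times$ with the subset $\{(y,z)\in\mathbf k^2 : yz=1\}$ of $\mathbf k^2$; a subset of $\mathbf k^n$ is Kolchin closed if it is the set of common zeros of a set of differential polynomials in $\mathbf k\{y_1,\dots,y_n\}$, and a map from a subset of $\mathbf k^n$ to $\mathbf k$ is a differential polynomial map if it is given by an element of $\mathbf k\{y_1,\dots,y_n\}$ (so a differential polynomial map on a subset of $\mathbf k^\times$ is one of the form $a\mapsto f(a,a^{-1})$ with $f\in\mathbf k\{y,z\}$). Let $A\subset\mathbf k^\times$ be a Kolchin-closed subgroup that contains an element $a$ with $a'\neq 0$. Let $\varphi:A\to\mathbf k$ and $\psi:\mathbf k\to\mathbf k$ be differential polynomial maps such that $$\varphi(ab)=a\varphi(b)+b\varphi(a)\quad\text{for all } a,b\in A,$$ $$\psi(ax)=a\psi(x)+x\varphi(a)\quad\text{for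 all } a\in A,\ x\in\mathbf k.$$ Then there exist $a_0,a_1\in\mathbf k$ such that $$\psi(x)=a_0x+a_1x'\ \text{ for all } x\in\mathbf k\qquad\text{and}\qquad \varphi(a)=a_1a'\ \text{ for all } a\in A.$$ -/

import Mathlib

open scoped Differential

/-- The ring `k{y₁, …, yₙ}` of differential polynomials over `k` in `n` differential indeterminates
(one derivation): the polynomial ring in the indeterminates `yⱼ⁽ⁱ⁾`, where the pair `(j, i)` stands
for the `i`-th derivative of `yⱼ`. -/
abbrev DiffPoly (n : ℕ) (k : Type*) [CommRing k] : Type _ :=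
  MvPolynomial (Fin n × ℕ) k

/-- The value `f(x) ∈ L` of a differential polynomial `f` over `k` at a point `x` of `Lⁿ`, where `L`
is a differential algebra over `k`: every `yⱼ⁽ⁱ⁾` is replaced by the `i`-th derivative of `xⱼ`. -/
noncomputable def DiffPoly.eval {n : ℕ} {k : Type*} [CommRing k] {L : Type*} [CommRing L]
    [Differential L] [Algebra k L] (x : Fin n → L) (f : DiffPoly n k) : L :=
  MvPolynomial.aeval
    (fun p : Fin n × ℕ => (fun z : L => z′)^[p.2] (x p.1)) f

/-- A differential field `k` is differentially closed if every finite system of differential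
polynomial equations over `k`, in finitely many indeterminates, that has a solution in some
differential field extension of `k` has a solution in `k`. (A solution generates over `k` an
extension of cardinality at most `max |k| ℵ₀`, so extensions in the universe of `k` suffice.) -/
def IsDifferentiallyClosed.{u} (k : Type u) [Field k] [Differential k] : Prop :=
  ∀ (n : ℕ) (S : Finset (DiffPoly n k)) (L : Type u) [Field L] [Differential L] [Algebra k L]
    [DifferentialAlgebra k L],
    (∃ x : Fin n → L, ∀ f ∈ S, DiffPoly.eval x f = 0) →
      ∃ x : Fin n → k, ∀ f ∈ S, DiffPoly.eval x f = 0

/-- A subset of `kⁿ` is Kolchin closed if it is the set of common zeros of some set of differential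
polynomials with coefficients in `k`. -/
def IsKolchinClosed {n : ℕ} {k : Type*} [Field k] [Differential k] (W : Set (Fin n → k)) : Prop :=
  ∃ S : Set (DiffPoly n k), W = {x | ∀ f ∈ S, DiffPoly.eval x f = 0}

/-- The identification of `kˣ` with the closed subset `y z = 1` of `k²`. -/
def unitsCoord {k : Type*} [Field k] (u : kˣ) : Fin 2 → k :=
  ![(u : k), ((u⁻¹ : kˣ) : k)]

/-- A subgroup of `kˣ` is Kolchin closed if it is so as a subset of `k²`, through `u ↦ (u, u⁻¹)`. -/
def Subgroup.IsKolchinClosedUnits {k : Type*} [Field k] [Differential k] (A : Subgroup kˣ) : Prop :=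
  IsKolchinClosed (unitsCoord '' (A : Set kˣ))

/-- A map `φ : X → k`, where `X` is viewed in `kⁿ` through the coordinate map `ι`, is a differential
polynomial map if it is given by a differential polynomial in the coordinates. -/
def IsDiffPolyMap {n : ℕ} {k : Type*} [Field k] [Differential k] {X : Type*} (ι : X → Fin n → k)
    (φ : X → k) : Prop :=
  ∃ f : DiffPoly n k, ∀ x : X, φ x = DiffPoly.eval (ι x) f

/-! Fix `a ∈ A` with `a′ ≠ 0` and put `u = a′ / a`. Iterating the rule for `ψ` makes `ψ (aᵐ x)`
equal to `aᵐ` times a polynomial in `m` of degree at most one. The degree-`d` component of the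
differential polynomial `P` defining `ψ` contributes `(aᵈ)ᵐ R_d(m)`, with `R_d` a polynomial. The
bases `aᵈ` are distinct, so independence of exponential polynomials isolates `R_1`. Since `(aᵐ x)⁽ʲ⁾
= aᵐ Q_j(m)` with `Q_j` having top term `uʲ x mʲ`, the linear part of `P` involves only `y` and
`y′`. -/

/-- The `n`-th power of `shift - b` sends `m ↦ b ^ m * Q m` to `m ↦ b ^ (m + n) * Δⁿ Q m`. -/
theorem shift_sub_smul_pow_apply {k : Type*} [Field k] (b : k) (Q : k → k) (n : ℕ) :
    ((LinearMap.funLeft k k Nat.succ - b • (1 : Module.End k (ℕ → k))) ^ n)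
        (fun m => b ^ m * Q m) =
      fun m => b ^ (m + n) * (fwdDiff 1)^[n] Q m := by
  induction n with
  | zero => simp
  | succ n ih =>
    rw [pow_succ', Module.End.mul_apply, ih]
    funext m
    simp only [LinearMap.sub_apply, LinearMap.smul_apply, Module.End.one_apply, Pi.sub_apply,
      LinearMap.funLeft_apply, Pi.smul_apply, smul_eq_mul, Function.iterate_succ_apply', fwdDiff,
      Nat.succ_eq_add_one]
    push_cast
    ring

open Polynomial in
/-- Exponential polynomials `m ↦ b ^ m * Q m` are generalized eigenvectors of the shift. -/
theorem pow_mul_eval_mem_maxGenEigenspace {k : Type*} [Field k] (b : k) (Q : k[X]) :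
    (fun m : ℕ => b ^ m * Q.eval (m : k)) ∈
      Module.End.maxGenEigenspace (LinearMap.funLeft k k Nat.succ) b := by
  rw [Module.End.mem_maxGenEigenspace]
  refine ⟨Q.natDegree + 1, ?_⟩
  rw [shift_sub_smul_pow_apply b Q.eval,
    Polynomial.fwdDiff_iter_eq_zero_of_degree_lt (Nat.lt_succ_self _)]
  funext m
  simp

open Polynomial in
/-- Exponential polynomials with distinct bases are linearly independent. -/
theorem pow_mul_eval_eq_zero_of_sum_eq_zero {k ι : Type*} [Field k] (s : Finset ι) (b : ι → k)
    (hb : Function.Injective b) (Q : ι → k[X])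
    (h : ∀ m : ℕ, ∑ i ∈ s, b i ^ m * (Q i).eval (m : k) = 0) :
    ∀ i ∈ s, ∀ m : ℕ, b i ^ m * (Q i).eval (m : k) = 0 := by
  have hind := (Module.End.independent_maxGenEigenspace
    (LinearMap.funLeft k k Nat.succ : Module.End k (ℕ → k))).comp hb
  rw [iSupIndep_iff_finsetSum_eq_zero_imp_eq_zero] at hind
  intro i hi m
  refine congrFun (hind s (fun i m => b i ^ m * (Q i).eval (m : k))
    (fun i _ => pow_mul_eval_mem_maxGenEigenspace (b i) (Q i)) ?_ i hi) m
  funext m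
  simpa using h m

/-- An element of a differential field of characteristic zero with nonzero derivative is not a root
of unity. -/
theorem pow_injective_of_deriv_ne_zero {k : Type*} [Field k] [CharZero k] [Differential k] {a : k}
    (ha : a′ ≠ 0) : Function.Injective (fun n : ℕ => a ^ n) := by
  have ha0 : a ≠ 0 := by rintro rfl; simp at ha
  have key : ∀ n : ℕ, a ^ (n + 1) ≠ 1 := by
    intro n hn
    have h := congrArg (fun z : k => z′) hn
    simp only [Derivation.leibniz_pow, Derivation.map_one_eq_zero] at h
    simp [ha, ha0] at h
    exact absurd h (by exact_mod_cast Nat.succ_ne_zero n)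
  have aux : ∀ i j : ℕ, i < j → a ^ i ≠ a ^ j := by
    intro i j hij h
    obtain ⟨d, rfl⟩ := Nat.exists_eq_add_of_lt hij
    rw [add_assoc, pow_add] at h
    exact key d (mul_left_cancel₀ (pow_ne_zero i ha0) (by rw [mul_one]; exact h.symm))
  intro i j h
  rcases lt_trichotomy i j with hij | hij | hij
  · exact absurd h (aux i j hij)
  · exact hij
  · exact absurd h.symm (aux j i hij)

open Polynomial in
/-- The polynomials `Qⱼ` with `(aᵐ x)⁽ʲ⁾ = aᵐ Qⱼ(m)`, where `u = a′ / a`. -/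
noncomputable def powMulDerivPoly {k : Type*} [Field k] [Differential k] (u x : k) : ℕ → k[X]
  | 0 => C x
  | j + 1 => C u * X * powMulDerivPoly u x j + Differential.mapCoeffs (powMulDerivPoly u x j)

-- Differentiating `aᵐ` brings out the factor `m u`; as `m` is a constant, `Q(m)′` only
-- differentiates the coefficients of `Q`.
open Polynomial in
theorem iterate_deriv_pow_mul {k : Type*} [Field k] [Differential k] {a : k} (ha : a ≠ 0) (x : k)
    (j m : ℕ) :
    (fun z : k => z′)^[j] (a ^ m * x) = a ^ m * (powMulDerivPoly (a′ / a) x j).eval (m : k) := by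
  induction j with
  | zero => simp [powMulDerivPoly]
  | succ j ih =>
    rw [Function.iterate_succ_apply', ih, powMulDerivPoly]
    have h := Differential.deriv_aeval_eq (A := k) (m : k) (powMulDerivPoly (a′ / a) x j)
    simp only [Polynomial.coe_aeval_eq_eval, Derivation.map_natCast, mul_zero, add_zero] at h
    rw [Derivation.leibniz, h, Derivation.leibniz_pow]
    simp only [eval_add, eval_mul, eval_C, eval_X, smul_eq_mul, nsmul_eq_mul]
    -- The exponent `m - 1` is truncated at `m = 0`.
    cases m with
    | zero => simp
    | succ m =>
      simp only [Nat.add_sub_cancel]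
      field_simp
      ring

open Polynomial in
theorem coeff_powMulDerivPoly_eq_zero {k : Type*} [Field k] [Differential k] (u x : k) (j n : ℕ)
    (h : j < n) : (powMulDerivPoly u x j).coeff n = 0 := by
  induction j generalizing n with
  | zero => simp [powMulDerivPoly, coeff_C, (by lia : n ≠ 0)]
  | succ j ih =>
    obtain ⟨n, rfl⟩ : ∃ r, n = r + 1 := ⟨n - 1, by lia⟩
    simp [powMulDerivPoly, mul_assoc, ih n (by lia), ih (n + 1) (by lia)]

-- Only multiplication by `C u * X` raises the degree.
open Polynomial in
theorem coeff_powMulDerivPoly_self {k : Type*} [Field k] [Differential k] (u x : k) (j : ℕ) :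
    (powMulDerivPoly u x j).coeff j = u ^ j * x := by
  induction j with
  | zero => simp [powMulDerivPoly]
  | succ j ih =>
    simp [powMulDerivPoly, mul_assoc, ih, coeff_powMulDerivPoly_eq_zero u x j (j + 1), pow_succ']

/-- Evaluating a homogeneous polynomial of degree `d` at a multiple of a point. -/
theorem MvPolynomial.IsHomogeneous.aeval_mul_left {σ k : Type*} [CommRing k] {d : ℕ}
    {F : MvPolynomial σ k} (hF : F.IsHomogeneous d) (c : k) (g : σ → k) :
    MvPolynomial.aeval (fun p => c * g p) F = c ^ d * MvPolynomial.aeval g F := by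
  rw [MvPolynomial.aeval_def, MvPolynomial.aeval_def, MvPolynomial.eval₂_eq, MvPolynomial.eval₂_eq,
    Finset.mul_sum]
  refine Finset.sum_congr rfl fun e he => ?_
  have hd : ∑ i ∈ e.support, e i = d := by
    have := hF (MvPolynomial.mem_support_iff.mp he)
    simpa [Finsupp.weight_apply, Finsupp.sum] using this
  simp only [mul_pow, Finset.prod_mul_distrib, Finset.prod_pow_eq_pow_sum, hd]
  ring

open Polynomial in
theorem DiffPoly.eval_pow_mul_of_isHomogeneous {k : Type*} [Field k] [Differential k] {a : k}
    (ha : a ≠ 0) {d : ℕ} {F : DiffPoly 1 k} (hF : F.IsHomogeneous d) (x : k) (m : ℕ) :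
    DiffPoly.eval (fun _ => a ^ m * x) F = (a ^ d) ^ m *
      (MvPolynomial.aeval (fun p => powMulDerivPoly (a′ / a) x p.2) F : k[X]).eval (m : k) := by
  have h : (MvPolynomial.aeval (fun p => powMulDerivPoly (a′ / a) x p.2) F : k[X]).eval (m : k) =
      MvPolynomial.aeval (fun p => (powMulDerivPoly (a′ / a) x p.2).eval (m : k)) F := by
    rw [← Polynomial.coe_aeval_eq_eval, ← AlgHom.comp_apply, MvPolynomial.comp_aeval]
  rw [h, ← pow_mul, mul_comm d m, pow_mul, ← hF.aeval_mul_left]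
  simp only [DiffPoly.eval, iterate_deriv_pow_mul ha]

/-- A homogeneous differential polynomial of degree one in one indeterminate is a linear
combination of the `y⁽ʲ⁾`. -/
theorem DiffPoly.exists_eq_sum_of_isHomogeneous_one {k : Type*} [Field k] {F : DiffPoly 1 k}
    (hF : F.IsHomogeneous 1) :
    ∃ c : ℕ →₀ k, F = c.sum fun j r => MvPolynomial.C r * MvPolynomial.X (0, j) := by
  have h : F ∈ Submodule.span k
      (Set.range fun j : ℕ => (MvPolynomial.X (0, j) : DiffPoly 1 k)) := by
    rw [← MvPolynomial.mem_homogeneousSubmodule,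
      MvPolynomial.homogeneousSubmodule_one_eq_span_X] at hF
    refine Submodule.span_mono ?_ hF
    rintro _ ⟨⟨i, j⟩, rfl⟩
    exact ⟨j, by rw [Subsingleton.elim i 0]⟩
  obtain ⟨c, hc⟩ := Finsupp.mem_span_range_iff_exists_finsupp.mp h
  exact ⟨c, by simp only [← hc, MvPolynomial.smul_eq_C_mul]⟩

open Polynomial in
/-- If the values of a differential polynomial at `aᵐ x` are `aᵐ (r x + m s x)` with `a` not
constant, then only its linear part of order at most one contributes. -/
theorem DiffPoly.exists_eval_eq_of_eval_pow_mul {k : Type*} [Field k] [CharZero k] [Differential k]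
    {a : k} (ha : a′ ≠ 0) (P : DiffPoly 1 k) (r s : k → k)
    (h : ∀ (x : k) (m : ℕ), DiffPoly.eval (fun _ => a ^ m * x) P = a ^ m * (r x + m * s x)) :
    ∃ c₀ c₁ : k, ∀ x : k, DiffPoly.eval (fun _ => x) P = c₀ * x + c₁ * x′ := by
  have ha0 : a ≠ 0 := by rintro rfl; simp at ha
  have hu : a′ / a ≠ 0 := div_ne_zero ha ha0
  set R : k → ℕ → k[X] := fun x d => MvPolynomial.aeval
    (fun p => powMulDerivPoly (a′ / a) x p.2) (MvPolynomial.homogeneousComponent d P) with hR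
  have hlin : ∀ x, R x 1 = C (r x) + X * C (s x) := by
    intro x
    -- The `+ 2` keeps degree 1 in the range even when `P` is constant.
    set N := P.totalDegree + 2
    have hsum : ∑ d ∈ Finset.range N, MvPolynomial.homogeneousComponent d P = P := by
      rw [Finset.sum_range_succ, MvPolynomial.homogeneousComponent_eq_zero _ _ (Nat.lt_succ_self _),
        add_zero, MvPolynomial.sum_homogeneousComponent]
    have h1 : 1 ∈ Finset.range N := by simp [N]
    have hz := pow_mul_eval_eq_zero_of_sum_eq_zero (Finset.range N) (fun d => a ^ d)
      (pow_injective_of_deriv_ne_zero ha)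
      (fun d => R x d - if d = 1 then C (r x) + X * C (s x) else 0) (by
        intro m
        have e : ∑ d ∈ Finset.range N, (a ^ d) ^ m * (R x d).eval (m : k) =
            a ^ m * (r x + m * s x) := by
          rw [← h]
          conv_rhs => rw [← hsum]
          rw [DiffPoly.eval, map_sum]
          refine Finset.sum_congr rfl fun d _ => ?_
          exact (DiffPoly.eval_pow_mul_of_isHomogeneous ha0
            (MvPolynomial.homogeneousComponent_isHomogeneous d P) x m).symm
        simp only [eval_sub, mul_sub, Finset.sum_sub_distrib, e]
        rw [Finset.sum_eq_single_of_mem 1 h1 (by intro d _ hd; simp [hd])]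
        simp only [if_true, eval_add, eval_mul, eval_C, eval_X, pow_one]
        ring)
      1 h1
    rw [← sub_eq_zero]
    refine Polynomial.eq_zero_of_infinite_isRoot _ ((Set.infinite_range_of_injective
      (Nat.cast_injective (R := k))).mono ?_)
    rintro _ ⟨m, rfl⟩
    simpa [ha0] using hz m
  obtain ⟨c, hc⟩ := DiffPoly.exists_eq_sum_of_isHomogeneous_one
    (MvPolynomial.homogeneousComponent_isHomogeneous 1 P)
  have hRc : ∀ x, R x 1 = c.sum fun j t => C t * powMulDerivPoly (a′ / a) x j := by
    intro x
    simp [hR, hc, Finsupp.sum, map_sum]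
  have hsupp : c.support ⊆ Finset.range 2 := by
    by_contra hne
    obtain ⟨i, hi, hi2⟩ := Finset.not_subset.mp hne
    have hne' : c.support.Nonempty := ⟨i, hi⟩
    set n := c.support.max' hne' with hn
    have hnm : n ∈ c.support := Finset.max'_mem _ _
    have hn2 : 2 ≤ n := le_trans (by simp at hi2; lia) (Finset.le_max' _ _ hi)
    -- At `x = 1` the top coefficient gives `c n * u ^ n = 0`, against `u ≠ 0`.
    have e := congrArg (fun p => p.coeff n) ((hRc 1).symm.trans (hlin 1))
    obtain ⟨q, hq⟩ : ∃ q, n = q + 2 := ⟨n - 2, by lia⟩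
    have e2 : (C (r 1) + X * C (s 1) : k[X]).coeff n = 0 := by
      rw [hq]; simp
    simp only [e2, Finsupp.sum, finsetSum_coeff, coeff_C_mul] at e
    rw [Finset.sum_eq_single_of_mem n hnm, coeff_powMulDerivPoly_self] at e
    · rw [mul_one] at e
      exact Finsupp.mem_support_iff.mp hnm ((mul_eq_zero.mp e).resolve_right (pow_ne_zero n hu))
    · intro j hj hjn
      rw [coeff_powMulDerivPoly_eq_zero _ _ _ _ (lt_of_le_of_ne (Finset.le_max' _ _ hj) hjn),
        mul_zero]
  refine ⟨c 0, c 1, fun x => ?_⟩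
  have e0 : DiffPoly.eval (fun _ => x) P = r x := by simpa using h x 0
  -- At `m = 0` the values of `Q_0` and `Q_1` are `x` and `x′`.
  have e1 := congrArg (fun p => p.eval 0) ((hRc x).symm.trans (hlin x))
  rw [e0]
  rw [Finsupp.sum_of_support_subset _ hsupp _ (by simp)] at e1
  simp only [Finset.sum_range_succ, Finset.sum_range_zero, zero_add, eval_add, eval_mul,
    eval_C, eval_X, zero_mul, add_zero] at e1
  rw [← e1]
  have d0 := iterate_deriv_pow_mul ha0 x 0 0
  have d1 := iterate_deriv_pow_mul ha0 x 1 0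
  simp only [pow_zero, one_mul, Function.iterate_zero, id, Nat.cast_zero, Function.iterate_one]
    at d0 d1
  rw [← d0, ← d1]

theorem mainTheorem8 {k : Type*} [Field k] [CharZero k] [Differential k]
    (hk : IsDifferentiallyClosed k)
    (A : Subgroup kˣ) (hA : A.IsKolchinClosedUnits)
    (hnc : ∃ a ∈ A, (a : k)′ ≠ 0)
    (φ : A → k) (hφ : IsDiffPolyMap (fun a : A => unitsCoord (a : kˣ)) φ)
    (ψ : k → k) (hψ : IsDiffPolyMap (fun (x : k) (_ : Fin 1) => x) ψ)
    (hφmul : ∀ a b : A, φ (a * b) = ((a : kˣ) : k) * φ b + ((b : kˣ) : k) * φ a)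
    (hψmul : ∀ (a : A) (x : k),
      ψ (((a : kˣ) : k) * x) = ((a : kˣ) : k) * ψ x + x * φ a) :
    ∃ a₀ a₁ : k, (∀ x : k, ψ x = a₀ * x + a₁ * x′) ∧
      ∀ a : A, φ a = a₁ * ((a : kˣ) : k)′ := by
  obtain ⟨a, haA, ha⟩ := hnc
  obtain ⟨P, hP⟩ := hψ
  have ha0 : (a : k) ≠ 0 := a.ne_zero
  have hpow : ∀ (x : k) (m : ℕ),
      ψ ((a : k) ^ m * x) = (a : k) ^ m * (ψ x + m * (x * φ ⟨a, haA⟩ / a)) := by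
    intro x m
    induction m with
    | zero => simp
    | succ m ih =>
      have h := hψmul ⟨a, haA⟩ ((a : k) ^ m * x)
      simp only at h
      rw [pow_succ', mul_assoc, h, ih]
      push_cast
      field_simp
      ring
  obtain ⟨c₀, c₁, hc⟩ := DiffPoly.exists_eval_eq_of_eval_pow_mul ha P ψ
    (fun x => x * φ ⟨a, haA⟩ / a) (fun x m => by rw [← hP, hpow])
  simp only [← hP] at hc
  refine ⟨c₀, c₁, hc, fun b => ?_⟩
  -- `φ b = ψ b - b * ψ 1`, and `ψ 1 = c₀` because `1′ = 0`.
  have h := hψmul b 1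
  simp only [mul_one, one_mul, hc, Derivation.map_one_eq_zero, mul_zero, add_zero] at h
  linear_combination -h
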